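/- A (concrete) operator space is a linear subspace $\mathcal{E}\subseteq B(\mathcal{H})$ for a complex Hilbert space $\mathcal{H}$; the space $M_n(\mathcal{E})$ of $n\times n$ matrices over $\mathcal{E}$ carries the norm inherited from the C*-algebra $M_n(B(\mathcal{H}))=B(\mathcal{H}^n)$. It is selfadjoint if $e^*\in\mathcal{E}$ for all $e\in\mathcal{E}$. For a linear map $i$ and a matrix $a=[a_{kl}]$ write $i(a)=[i(a_{kl})]$. A linear map $\varphi$ between operator spaces is completely contractive (respectively, completely isometric) if $\|\varphi(a)\|\le\|a\|$ (respectively, $\|\varphi(a)\|=\|a\|$) for all $n$ and all $a\in M_n(\mathcal{E})$. Let $C^*_{\max}(\mathcal{E})$ be the maximal C*-algebra of $\mathcal{E}$, i.e. the unital C*-algebra generated by the image of $\mathcal{E}$ under the direct sum of all completely contractive maps $\mathcal{E}\to B(\mathcal{K})$, and let $\iota_{\mathcal{E}}\colon\mathcal{E}\to C^*_{\max}(\mathcal{E})$ be the canonical embedding. For $a\in M_n(\mathcal{E})$ let $$\rho_{\mathcal{E}}(a)=\sup\{|\lambda| : \lambda\in\sigma(\iota_{\mathcal{E}}(a))\}$$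 be the spectral radius of $\iota_{\mathcal{E}}(a)$ in the C*-algebra $M_n(C^*_{\max}(\mathcal{E}))$. **Theorem.** Let $\mathcal{E}_1$ and $\mathcal{E}_2$ be selfadjoint operator spaces, and let $i\colon\mathcal{E}_1\to\mathcal{E}_2$ be a linear map that is $*$-preserving (i.e. $i(e^*)=i(e)^*$ for all $e\in\mathcal{E}_1$) but not completely isometric. Then there exist $n\in\mathbb{N}$ and $a\in M_n(\mathcal{E}_1)$ such that $$\rho_{\mathcal{E}_1}(a)\neq\rho_{\mathcal{E}_2}(i(a)).$$ -/

import Mathlib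

universe u v

namespace OpSpace

noncomputable section

section Concrete

variable {H : Type u} [NormedAddCommGroup H] [InnerProductSpace ℂ H] [CompleteSpace H]

/-- The norm of `M_n(E)`, for a concrete operator space `E ⊆ B(H)`: the norm inherited from the
C⋆-algebra `M_n(B(H))`. -/
def matNorm (E : Submodule ℂ (H →L[ℂ] H)) {n : ℕ} (a : Matrix (Fin n) (Fin n) E) : ℝ :=
  ‖CStarMatrix.ofMatrix (a.map (fun e : E => (e : H →L[ℂ] H)))‖

/-- A concrete operator space `E ⊆ B(H)` is selfadjoint if `e⋆ ∈ E` for all `e ∈ E`. -/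
def IsSelfadjointSpace (E : Submodule ℂ (H →L[ℂ] H)) : Prop :=
  ∀ e ∈ E, star e ∈ E

/-- Complete contractions `φ : E → B(K)`: linear maps all of whose entrywise amplifications
`M_n(E) → M_n(B(K))` are contractive. -/
def IsCompleteContraction (E : Submodule ℂ (H →L[ℂ] H)) {K : Type v} [NormedAddCommGroup K]
    [InnerProductSpace ℂ K] [CompleteSpace K] (φ : E →ₗ[ℂ] (K →L[ℂ] K)) : Prop :=
  ∀ (n : ℕ) (a : Matrix (Fin n) (Fin n) E),
    ‖CStarMatrix.ofMatrix (a.map φ)‖ ≤ matNorm E a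

/-- A completely contractive map of `E` into `B(K)`, for a nonzero Hilbert space `K`. The universe
of `K` is that of `H`; as `E` lives there too, this loses nothing: the C⋆-algebra generated by the
range of a complete contraction on a larger space is a direct sum of cyclic representations on
spaces of this universe. -/
structure Rep (E : Submodule ℂ (H →L[ℂ] H)) where
  K : Type u
  [normedAddCommGroup : NormedAddCommGroup K]
  [innerProductSpace : InnerProductSpace ℂ K]
  [completeSpace : CompleteSpace K]
  [nontrivial : Nontrivial K]
  toLin : E →ₗ[ℂ] (K →L[ℂ] K)
  cc : IsCompleteContraction E toLin

attribute [instance] Rep.normedAddCommGroup Rep.innerProductSpace Rep.completeSpace Rep.nontrivial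

/-- The C⋆-algebra of bounded families in `∏_φ B(K_φ)`, over all complete contractions
`φ : E → B(K_φ)`. -/
abbrev RepProd (E : Submodule ℂ (H →L[ℂ] H)) : Type (u + 1) :=
  lp (fun r : Rep E => r.K →L[ℂ] r.K) ⊤

instance (E : Submodule ℂ (H →L[ℂ] H)) : CStarAlgebra (RepProd E) where

theorem Rep.norm_toLin_le {E : Submodule ℂ (H →L[ℂ] H)} (r : Rep E) (e : E) :
    ‖r.toLin e‖ ≤ matNorm E (Matrix.of fun _ _ : Fin 1 => e) :=
  (CStarMatrix.norm_entry_le_norm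
    (M := CStarMatrix.ofMatrix ((Matrix.of fun _ _ : Fin 1 => e).map r.toLin))
    (i := 0) (j := 0)).trans (r.cc 1 _)

/-- The linear map `e ↦ (φ(e))_φ`. -/
def toRepProd (E : Submodule ℂ (H →L[ℂ] H)) : E →ₗ[ℂ] RepProd E where
  toFun e := ⟨fun r => r.toLin e, memℓp_infty
    ⟨matNorm E (Matrix.of fun _ _ : Fin 1 => e), by
      rintro _ ⟨r, rfl⟩
      exact r.norm_toLin_le e⟩⟩
  map_add' x y := by
    ext r : 2
    exact map_add r.toLin x y
  map_smul' c x := by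
    ext r : 2
    exact map_smul r.toLin c x

/-- The maximal (universal) C⋆-algebra `C⋆_max(E)`: the unital C⋆-algebra generated by
the image of `E` under the direct sum of all complete contractions of `E` into some `B(K)`. -/
def cmaxSubalgebra (E : Submodule ℂ (H →L[ℂ] H)) : StarSubalgebra ℂ (RepProd E) :=
  (StarAlgebra.adjoin ℂ (Set.range (toRepProd E))).topologicalClosure

/-- `C⋆_max(E)` as a type. -/
def CMax (E : Submodule ℂ (H →L[ℂ] H)) : Type (u + 1) := cmaxSubalgebra E

/-- `C⋆_max(E)` is a C⋆-algebra, with the structure inherited from `RepProd E`. -/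
instance (E : Submodule ℂ (H →L[ℂ] H)) : CStarAlgebra (CMax E) :=
  StarSubalgebra.cstarAlgebra (cmaxSubalgebra E)
    (h_closed := StarSubalgebra.isClosed_topologicalClosure _)

/-- The canonical embedding `ι_E : E → C⋆_max(E)`. -/
def iota (E : Submodule ℂ (H →L[ℂ] H)) : E →ₗ[ℂ] CMax E where
  toFun e := ⟨toRepProd E e,
    StarSubalgebra.le_topologicalClosure _ (StarAlgebra.subset_adjoin ℂ _ ⟨e, rfl⟩)⟩
  map_add' x y := Subtype.ext (map_add (toRepProd E) x y)
  map_smul' c x := Subtype.ext (map_smul (toRepProd E) c x)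

/-- The joint spectral radius `ρ_E(a)` of `a ∈ M_n(E)`: the spectral radius of the matrix
`[ι_E(a_ij)]` in the C⋆-algebra `M_n(C⋆_max(E)) = M_n ⊗ C⋆_max(E)`. -/
def rho (E : Submodule ℂ (H →L[ℂ] H)) {n : ℕ} (a : Matrix (Fin n) (Fin n) E) : ℝ :=
  (spectralRadius ℂ (CStarMatrix.ofMatrix (a.map (iota E)))).toReal

end Concrete

section Maps

variable {H₁ : Type u} [NormedAddCommGroup H₁] [InnerProductSpace ℂ H₁] [CompleteSpace H₁]
  {H₂ : Type v} [NormedAddCommGroup H₂] [InnerProductSpace ℂ H₂] [CompleteSpace H₂]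

/-- A linear map of concrete operator spaces is completely isometric if all its entrywise
amplifications `M_n(E₁) → M_n(E₂)` preserve the norm. -/
def IsCompletelyIsometric {E₁ : Submodule ℂ (H₁ →L[ℂ] H₁)} {E₂ : Submodule ℂ (H₂ →L[ℂ] H₂)}
    (i : E₁ →ₗ[ℂ] E₂) : Prop :=
  ∀ (n : ℕ) (a : Matrix (Fin n) (Fin n) E₁), matNorm E₂ (a.map i) = matNorm E₁ a

/-- A linear map `i` of selfadjoint operator spaces is ⋆-preserving if `i(e⋆) = i(e)⋆`. -/
def IsStarPreserving {E₁ : Submodule ℂ (H₁ →L[ℂ] H₁)} {E₂ : Submodule ℂ (H₂ →L[ℂ] H₂)}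
    (hE₁ : IsSelfadjointSpace E₁) (i : E₁ →ₗ[ℂ] E₂) : Prop :=
  ∀ e : E₁, (i ⟨star (e : H₁ →L[ℂ] H₁), hE₁ e e.2⟩ : H₂ →L[ℂ] H₂) = star (i e : H₂ →L[ℂ] H₂)

end Maps

end

end OpSpace

open scoped ENNReal

namespace OpSpace

noncomputable section

section CStarAlgebra

/-! On selfadjoint matrices `rho` recovers the norm. It never exceeds `matNorm`; conversely the
inclusion `E ⊆ B(H)` is itself a complete contraction, so spectra in `M_n(CMax E)` contain those in
`M_n(B(H))`, where spectral radius and norm agree on selfadjoint elements. Note that `iota` need not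
preserve adjoints. Given `‖i(a)‖ ≠ ‖a‖`, replace `a` by the selfadjoint block matrix with
off-diagonal entries `a`, `a⋆`. Its norm is `‖a‖`, and a ⋆-preserving `i` commutes with this
doubling, so `rho` distinguishes the doubled matrix from its image. -/

theorem isSelfAdjoint_ofMatrix {n A : Type*} [Star A] {a : Matrix n n A}
    (ha : a.conjTranspose = a) : IsSelfAdjoint (CStarMatrix.ofMatrix a) :=
  ha

/-- A family of ⋆-homomorphisms that jointly separates the points of a C⋆-algebra determines its
norm. -/
theorem norm_le_of_forall_starHom_norm_le {ι A : Type*} {B : ι → Type*} [NonUnitalCStarAlgebra A]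
    [∀ r, NonUnitalCStarAlgebra (B r)] (π : ∀ r, A →⋆ₙₐ[ℂ] B r)
    (hπ : ∀ a, (∀ r, π r a = 0) → a = 0) {a : A} {C : ℝ} (hC : 0 ≤ C)
    (h : ∀ r, ‖π r a‖ ≤ C) : ‖a‖ ≤ C := by
  let Φ : A →⋆ₙₐ[ℂ] lp B ∞ :=
    { toFun := fun a => ⟨fun r => π r a, memℓp_infty ⟨‖a‖, by
        rintro _ ⟨r, rfl⟩
        exact NonUnitalStarAlgHom.norm_apply_le (π r) a⟩⟩
      map_smul' := fun c x => by ext r : 2; exact map_smul (π r) c x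
      map_zero' := by ext r : 2; exact map_zero (π r)
      map_add' := fun x y => by ext r : 2; exact map_add (π r) x y
      map_mul' := fun x y => by ext r : 2; exact map_mul (π r) x y
      map_star' := fun x => by ext r : 2; exact map_star (π r) x }
  have hΦ : Function.Injective Φ := (injective_iff_map_eq_zero Φ).2 fun x hx =>
    hπ x fun r => congrFun (congrArg Subtype.val hx) r
  rw [← NonUnitalStarAlgHom.norm_map Φ hΦ a]
  exact lp.norm_le_of_forall_le hC h

/-- The zero algebra has to be allowed, since it occurs for `0 × 0` matrices. -/
theorem spectralRadius_le_nnnorm {A : Type*} [CStarAlgebra A] (a : A) :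
    spectralRadius ℂ a ≤ ‖a‖₊ := by
  rcases subsingleton_or_nontrivial A with _ | _
  · rw [Subsingleton.elim a 0, spectrum.spectralRadius_zero]
    exact zero_le
  · exact spectrum.spectralRadius_le_nnnorm a

/-- The entrywise amplification of a unital ⋆-homomorphism to matrices. -/
def matrixMap (n : Type*) [Fintype n] [DecidableEq n] {A B : Type*} [CStarAlgebra A]
    [CStarAlgebra B] (f : A →⋆ₐ[ℂ] B) : CStarMatrix n n A →⋆ₐ[ℂ] CStarMatrix n n B :=
  { CStarMatrix.mapₙₐ (n := n) (f : A →⋆ₙₐ[ℂ] B) with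
    map_one' := by
      ext i j
      by_cases h : i = j <;> simp [CStarMatrix.one_apply, h]
    commutes' := fun c => by
      ext i j
      by_cases h : i = j <;>
        simp [CStarMatrix.algebraMap_apply, h, Algebra.algebraMap_eq_smul_one] }

variable {A : Type*} [CStarAlgebra A] [PartialOrder A] [StarOrderedRing A]
  {n : Type*} [Fintype n]

/-- Block diagonal matrices as a ⋆-homomorphism. -/
def blockDiag : CStarMatrix n n A × CStarMatrix n n A →⋆ₙₐ[ℂ] CStarMatrix (n ⊕ n) (n ⊕ n) A where
  toFun p := CStarMatrix.ofMatrix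
    (Matrix.fromBlocks (CStarMatrix.ofMatrix.symm p.1) 0 0 (CStarMatrix.ofMatrix.symm p.2))
  map_smul' c x := by ext (i | i) (j | j) <;> simp
  map_zero' := by ext (i | i) (j | j) <;> simp
  map_add' x y := by ext (i | i) (j | j) <;> simp
  map_mul' x y := by ext (i | i) (j | j) <;> simp [CStarMatrix.mul_apply]
  map_star' x := by ext (i | i) (j | j) <;> simp [CStarMatrix.star_apply]

theorem norm_blockDiag (p : CStarMatrix n n A × CStarMatrix n n A) : ‖blockDiag p‖ = ‖p‖ := by
  refine NonUnitalStarAlgHom.norm_map blockDiag ((injective_iff_map_eq_zero _).2 fun x hx => ?_) p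
  refine Prod.ext ?_ ?_ <;> ext i j
  · exact congrFun (congrFun hx (Sum.inl i)) (Sum.inl j)
  · exact congrFun (congrFun hx (Sum.inr i)) (Sum.inr j)

/-- The selfadjoint matrix with off-diagonal blocks `a` and `a⋆` has the norm of `a`. -/
theorem norm_fromBlocks_zero_conjTranspose (a : Matrix n n A) :
    ‖CStarMatrix.ofMatrix (Matrix.fromBlocks 0 a a.conjTranspose 0)‖ =
      ‖CStarMatrix.ofMatrix a‖ := by
  set X := CStarMatrix.ofMatrix (Matrix.fromBlocks 0 a a.conjTranspose 0)
  set b := CStarMatrix.ofMatrix a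
  have hX : star X * X = blockDiag (b * star b, star b * b) := by
    ext (i | i) (j | j) <;>
      simp [X, b, blockDiag, CStarMatrix.mul_apply, CStarMatrix.star_apply]
  have h : ‖X‖ * ‖X‖ = ‖b‖ * ‖b‖ := by
    rw [← CStarRing.norm_star_mul_self, hX, norm_blockDiag, Prod.norm_def,
      CStarRing.norm_self_mul_star, CStarRing.norm_star_mul_self, max_self]
  exact (mul_self_inj (norm_nonneg _) (norm_nonneg _)).1 h

theorem norm_ofMatrix_reindex {m : Type*} [Fintype m] (e : n ≃ m)
    (a : Matrix n n A) :
    ‖CStarMatrix.ofMatrix (Matrix.reindex e e a)‖ = ‖CStarMatrix.ofMatrix a‖ :=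
  NonUnitalStarAlgHom.norm_map (CStarMatrix.reindexₐ ℂ A e)
    (CStarMatrix.reindexₐ ℂ A e).injective (CStarMatrix.ofMatrix a)

end CStarAlgebra

section Concrete

variable {H : Type u} [NormedAddCommGroup H] [InnerProductSpace ℂ H] [CompleteSpace H]
  {E : Submodule ℂ (H →L[ℂ] H)}

/-- The ⋆-homomorphism of `C⋆_max(E)` extending a complete contraction. -/
def Rep.starHom (r : Rep E) : CMax E →⋆ₐ[ℂ] (r.K →L[ℂ] r.K) where
  toFun x := x.1 r
  map_one' := rfl
  map_mul' _ _ := rfl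
  map_zero' := rfl
  map_add' _ _ := rfl
  commutes' _ := rfl
  map_star' _ := rfl

/-- The inclusion `E ⊆ B(H)` as a complete contraction. -/
def Rep.inclusion (E : Submodule ℂ (H →L[ℂ] H)) [Nontrivial H] : Rep E where
  K := H
  toLin := E.subtype
  cc _ _ := le_rfl

/-- The coordinates `r.starHom` separate the points of `CMax E`, and each sends `iota E` to a
complete contraction. -/
theorem rho_le_matNorm {n : ℕ} (a : Matrix (Fin n) (Fin n) E) : rho E a ≤ matNorm E a := by
  let _ : PartialOrder (CMax E) := CStarAlgebra.spectralOrder (CMax E)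
  have _ : StarOrderedRing (CMax E) := CStarAlgebra.spectralOrderedRing (CMax E)
  have h1 : ‖CStarMatrix.ofMatrix (a.map (iota E))‖ ≤ matNorm E a := by
    refine norm_le_of_forall_starHom_norm_le (B := fun r : Rep E =>
      CStarMatrix (Fin n) (Fin n) (r.K →L[ℂ] r.K))
      (fun r => (matrixMap (Fin n) r.starHom).toNonUnitalStarAlgHom) (fun x hx => ?_)
      (norm_nonneg _) fun r => r.cc n a
    ext i j
    refine Subtype.ext (Subtype.ext (funext fun r => ?_))
    exact congrFun (congrFun (hx r) i) j
  exact (ENNReal.toReal_mono ENNReal.coe_ne_top (spectralRadius_le_nnnorm _)).trans h1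

/-- The joint spectral radius of a selfadjoint matrix is its norm. -/
theorem rho_eq_matNorm {n : ℕ} (a : Matrix (Fin n) (Fin n) E)
    (ha : IsSelfAdjoint (CStarMatrix.ofMatrix (a.map (fun e : E => (e : H →L[ℂ] H))))) :
    rho E a = matNorm E a := by
  refine le_antisymm (rho_le_matNorm a) ?_
  -- If `H = 0`, the inclusion is not a `Rep`, but then `matNorm` vanishes.
  rcases subsingleton_or_nontrivial H with _ | _
  · rw [matNorm, Subsingleton.elim (CStarMatrix.ofMatrix _) 0, norm_zero]
    exact ENNReal.toReal_nonneg
  let _ : PartialOrder (CMax E) := CStarAlgebra.spectralOrder (CMax E)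
  have _ : StarOrderedRing (CMax E) := CStarAlgebra.spectralOrderedRing (CMax E)
  rw [matNorm, ← ha.toReal_spectralRadius_complex_eq_norm]
  refine ENNReal.toReal_mono
    (ne_top_of_le_ne_top ENNReal.coe_ne_top (spectralRadius_le_nnnorm _)) ?_
  -- A unital homomorphism can only shrink the spectrum.
  exact biSup_mono fun z hz => AlgHom.spectrum_apply_subset
    (matrixMap (Fin n) (Rep.inclusion E).starHom) (CStarMatrix.ofMatrix (a.map (iota E))) hz

/-- The selfadjoint matrix with off-diagonal blocks `a` and `a⋆`. -/
def selfadjointDouble (hE : IsSelfadjointSpace E) {n : ℕ} (a : Matrix (Fin n) (Fin n) E) :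
    Matrix (Fin (n + n)) (Fin (n + n)) E :=
  Matrix.reindex finSumFinEquiv finSumFinEquiv (Matrix.fromBlocks 0 a
    (Matrix.of fun i j => ⟨star (a j i : H →L[ℂ] H), hE _ (a j i).2⟩) 0)

theorem map_coe_selfadjointDouble (hE : IsSelfadjointSpace E) {n : ℕ}
    (a : Matrix (Fin n) (Fin n) E) :
    (selfadjointDouble hE a).map (fun e : E => (e : H →L[ℂ] H)) =
      Matrix.reindex finSumFinEquiv finSumFinEquiv (Matrix.fromBlocks 0
        (a.map (fun e : E => (e : H →L[ℂ] H)))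
        (a.map (fun e : E => (e : H →L[ℂ] H))).conjTranspose 0) := by
  rw [selfadjointDouble, Matrix.reindex_apply, Matrix.reindex_apply, ← Matrix.submatrix_map,
    Matrix.fromBlocks_map]
  congr 2

theorem matNorm_selfadjointDouble (hE : IsSelfadjointSpace E) {n : ℕ}
    (a : Matrix (Fin n) (Fin n) E) : matNorm E (selfadjointDouble hE a) = matNorm E a := by
  rw [matNorm, map_coe_selfadjointDouble, norm_ofMatrix_reindex,
    norm_fromBlocks_zero_conjTranspose, matNorm]

theorem rho_selfadjointDouble (hE : IsSelfadjointSpace E) {n : ℕ}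
    (a : Matrix (Fin n) (Fin n) E) : rho E (selfadjointDouble hE a) = matNorm E a := by
  rw [rho_eq_matNorm, matNorm_selfadjointDouble]
  rw [map_coe_selfadjointDouble]
  exact isSelfAdjoint_ofMatrix (by rw [Matrix.conjTranspose_reindex,
    Matrix.fromBlocks_conjTranspose, Matrix.conjTranspose_conjTranspose,
    Matrix.conjTranspose_zero])

end Concrete

theorem map_selfadjointDouble {H₁ : Type*} [NormedAddCommGroup H₁] [InnerProductSpace ℂ H₁]
    [CompleteSpace H₁] {H₂ : Type*} [NormedAddCommGroup H₂] [InnerProductSpace ℂ H₂]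
    [CompleteSpace H₂] {E₁ : Submodule ℂ (H₁ →L[ℂ] H₁)} {E₂ : Submodule ℂ (H₂ →L[ℂ] H₂)}
    (hE₁ : IsSelfadjointSpace E₁) (hE₂ : IsSelfadjointSpace E₂) {i : E₁ →ₗ[ℂ] E₂}
    (hi : IsStarPreserving hE₁ i) {n : ℕ} (a : Matrix (Fin n) (Fin n) E₁) :
    (selfadjointDouble hE₁ a).map i = selfadjointDouble hE₂ (a.map i) := by
  rw [selfadjointDouble, selfadjointDouble, Matrix.reindex_apply, Matrix.reindex_apply,
    ← Matrix.submatrix_map, Matrix.fromBlocks_map]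
  congr 2
  · ext; simp
  · ext k l
    -- Only the block of adjoints needs `i` to be ⋆-preserving.
    simp [hi (a l k)]
  · ext; simp

end

end OpSpace

theorem mainTheorem3
    {H₁ : Type u} [NormedAddCommGroup H₁] [InnerProductSpace ℂ H₁] [CompleteSpace H₁]
    {H₂ : Type v} [NormedAddCommGroup H₂] [InnerProductSpace ℂ H₂] [CompleteSpace H₂]
    (E₁ : Submodule ℂ (H₁ →L[ℂ] H₁)) (E₂ : Submodule ℂ (H₂ →L[ℂ] H₂))
    (hE₁ : OpSpace.IsSelfadjointSpace E₁) (hE₂ : OpSpace.IsSelfadjointSpace E₂)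
    (i : E₁ →ₗ[ℂ] E₂) (hstar : OpSpace.IsStarPreserving hE₁ i)
    (hi : ¬ OpSpace.IsCompletelyIsometric i) :
    ∃ (n : ℕ) (a : Matrix (Fin n) (Fin n) E₁),
      OpSpace.rho E₁ a ≠ OpSpace.rho E₂ (a.map i) := by
  obtain ⟨n, a, h⟩ : ∃ (n : ℕ) (a : Matrix (Fin n) (Fin n) E₁),
      OpSpace.matNorm E₂ (a.map i) ≠ OpSpace.matNorm E₁ a := by
    simpa [OpSpace.IsCompletelyIsometric] using hi
  refine ⟨n + n, OpSpace.selfadjointDouble hE₁ a, fun hρ => h ?_⟩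
  rw [OpSpace.map_selfadjointDouble hE₁ hE₂ hstar, OpSpace.rho_selfadjointDouble,
    OpSpace.rho_selfadjointDouble] at hρ
  exact hρ.symm
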